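/- Let $a,n\ge 0$ and let $r_1,\dots,r_a\ge 0$ be integers with $r_1+\dots+r_a=n$. For a word $w=w_1\cdots w_n$ on the ordered alphabet $\{1,\dots,a\}$, let $st(w)\in S_n$ be its standard permutation: $st(w)(i)$ is the rank of the letter $w_i$ among the letters of $w$, where of two equal letters the one further to the left is considered smaller. Let $U(w)$ be the multiset of necklaces (circular words) obtained by writing $\sigma=st(w)$ as a product of disjoint cycles $(x\ \sigma(x)\ \sigma^2(x)\cdots)$, fixed points included, and replacing each number $i$ by the letter $w_i$. A nonempty necklace is primitive if it is not equal to any of its nontrivial cyclic shifts. A permutation $\pi\in S_n$ has a descent at position $i$, $1\le i\le n$, if $i=n$ or $\pi(i)>\pi(i+1)$; its descent set is the set of these positions. Put $R=\{r_1,\,r_1+r_2,\,\dots,\,r_1+\cdots+r_a\}$, let $W$ be the set of words of length $n$ with exactly $r_i$ letters $i$ for each $i$, and let $N$ be the set of finite multisets of primitive necklaces on $\{1,\dots,a\}$ that contain, counted over the whole multiset, exactly $r_i$ letters $i$ for each $i$. Then: 1. $U$ restricts to a bijection from $W$ onto $N$, and $st$ restricts to a bijection from $W$ onto the set of $\pi\in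 S_n$ such that the descent set of $\pi^{-1}$ is contained in $R$. 2. Consequently there is a map $\bar U$ with $\bar U(st(w))=U(w)$ for all $w\in W$; it is a bijection from the set of $\pi\in S_n$ such that the descent set of $\pi^{-1}$ is contained in $R$ onto $N$, and it preserves cycle structure: the multiset of lengths of the necklaces in $\bar U(\pi)$ is the multiset of cycle lengths of $\pi$ (fixed points included). 3. Likewise $\pi\mapsto\bar U(\pi^{-1})$ is a cycle-structure preserving bijection from the set of $\pi\in S_n$ whose descent set is contained in $R$ onto $N$. The same holds if in the definition of $U$ all cycles are written in the opposite sense, $(x\ \sigma^{-1}(x)\ \sigma^{-2}(x)\cdots)$. -/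

import Mathlib

namespace GesselReutenauer

/-- The strict order on the positions of a word `w`: compare the letters first and, for equal
letters, count the one further to the left as the smaller one. -/
def Before {n : ℕ} {α : Type*} [LinearOrder α] (w : Fin n → α) (j i : Fin n) : Prop :=
  w j < w i ∨ (w j = w i ∧ j < i)

instance {n : ℕ} {α : Type*} [LinearOrder α] (w : Fin n → α) (j i : Fin n) :
    Decidable (Before w j i) :=
  inferInstanceAs (Decidable (w j < w i ∨ (w j = w i ∧ j < i)))

/-- The (zero-based) rank of the letter at position `i` among all the letters of `w`. -/
def rank {n : ℕ} {α : Type*} [LinearOrder α] (w : Fin n → α) (i : Fin n) : ℕ :=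
  (Finset.univ.filter fun j => Before w j i).card

theorem not_before_self {n : ℕ} {α : Type*} [LinearOrder α] (w : Fin n → α) (i : Fin n) :
    ¬ Before w i i := by
  simp [Before]

theorem rank_strict {n : ℕ} {α : Type*} [LinearOrder α] (w : Fin n → α) {i j : Fin n}
    (h : Before w i j) : rank w i < rank w j := by
  apply Finset.card_lt_card
  rw [Finset.ssubset_iff_of_subset]
  · exact ⟨i, by simpa using h, fun hi => not_before_self w i (Finset.mem_filter.1 hi).2⟩
  · intro k hk
    refine Finset.mem_filter.2 ⟨Finset.mem_univ k, ?_⟩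
    replace hk := (Finset.mem_filter.1 hk).2
    unfold Before at hk h ⊢
    rcases hk with hk | ⟨hk, hk'⟩ <;> rcases h with h | ⟨h, h'⟩
    · exact Or.inl (hk.trans h)
    · exact Or.inl (h ▸ hk)
    · exact Or.inl (hk ▸ h)
    · exact Or.inr ⟨hk.trans h, hk'.trans h'⟩

theorem rank_lt {n : ℕ} {α : Type*} [LinearOrder α] (w : Fin n → α) (i : Fin n) :
    rank w i < n := by
  have h : (Finset.univ.filter fun j => Before w j i) ⊂ Finset.univ := by
    rw [Finset.ssubset_iff_of_subset (Finset.subset_univ _)]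
    exact ⟨i, Finset.mem_univ i, fun hi => not_before_self w i (Finset.mem_filter.1 hi).2⟩
  simpa [rank] using Finset.card_lt_card h

theorem rank_bijective {n : ℕ} {α : Type*} [LinearOrder α] (w : Fin n → α) :
    Function.Bijective (fun i => (⟨rank w i, rank_lt w i⟩ : Fin n)) := by
  rw [← Finite.injective_iff_bijective]
  intro i j hij
  have hr : rank w i = rank w j := congrArg Fin.val hij
  by_contra hne
  have hb : Before w i j ∨ Before w j i := by
    simp only [Before]
    rcases lt_trichotomy (w i) (w j) with h | h | h
    · exact Or.inl (Or.inl h)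
    · rcases lt_or_gt_of_ne hne with h' | h'
      · exact Or.inl (Or.inr ⟨h, h'⟩)
      · exact Or.inr (Or.inr ⟨h.symm, h'⟩)
    · exact Or.inr (Or.inl h)
  rcases hb with h | h
  · exact (rank_strict w h).ne hr
  · exact (rank_strict w h).ne hr.symm

/-- The standard permutation `st(w)` of a word `w`: it sends a position to the rank of the letter
at this position. -/
noncomputable def st {n : ℕ} {α : Type*} [LinearOrder α] (w : Fin n → α) :
    Equiv.Perm (Fin n) :=
  Equiv.ofBijective (fun i => (⟨rank w i, rank_lt w i⟩ : Fin n)) (rank_bijective w)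

/-- The cycle `(x, σ x, σ² x, …)` of `σ` through `x`, as a circular arrangement; it has length one
if `x` is a fixed point. -/
noncomputable def cycleThrough {n : ℕ} (σ : Equiv.Perm (Fin n)) (x : Fin n) : Cycle (Fin n) :=
  (((List.range (Function.minimalPeriod σ x)).map fun k => (σ ^ k) x : List (Fin n)) :
    Cycle (Fin n))

/-- The set of all cycles of `σ`, fixed points included. -/
noncomputable def cycles {n : ℕ} (σ : Equiv.Perm (Fin n)) : Finset (Cycle (Fin n)) :=
  Finset.univ.image (cycleThrough σ)

/-- The map `U`: in every cycle of `st(w)` replace each number by the letter of `w` at this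
position. The sign `ε` is the sense in which the cycles of `σ = st(w)` are written down:
as `(x, σ x, σ² x, …)` for `ε = 1` and as `(x, σ⁻¹ x, σ⁻² x, …)` for `ε = -1`. -/
noncomputable def U {n : ℕ} {α : Type*} [LinearOrder α] (ε : ℤˣ) (w : Fin n → α) :
    Multiset (Cycle α) :=
  (cycles (st w ^ (ε : ℤ))).val.map (Cycle.map w)

/-- A primitive necklace: a nonempty circular word that differs from all of its nontrivial cyclic
shifts. -/
def IsPrimitive {α : Type*} (c : Cycle α) : Prop :=
  ∀ l : List α, (l : Cycle α) = c →
    l ≠ [] ∧ ∀ k : ℕ, 0 < k → k < l.length → l.rotate k ≠ l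

/-- The words of length `n` in which the letter `i` occurs `r i` times. -/
def wordsOfContent (n : ℕ) {a : ℕ} (r : Fin a → ℕ) : Set (Fin n → Fin a) :=
  {w | ∀ i, (Finset.univ.filter fun j => w j = i).card = r i}

/-- The multisets of primitive necklaces in which the letter `i` occurs `r i` times in total. -/
def necklacesOfContent {a : ℕ} (r : Fin a → ℕ) : Set (Multiset (Cycle (Fin a))) :=
  {M | (∀ c ∈ M, IsPrimitive c) ∧ ∀ i, (M.map fun c => c.toMultiset.count i).sum = r i}

/-- The descent set of `π`, with positions numbered `1, …, n`; the last position always counts as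
a descent. -/
def descentSet {n : ℕ} (π : Equiv.Perm (Fin n)) : Set ℕ :=
  {p | ∃ i : Fin n, p = (i : ℕ) + 1 ∧
    (p = n ∨ ∃ h : (i : ℕ) + 1 < n, π ⟨(i : ℕ) + 1, h⟩ < π i)}

/-- The set `{r₁, r₁ + r₂, …, r₁ + ⋯ + rₐ}`. -/
def partialSums {a : ℕ} (r : Fin a → ℕ) : Set ℕ :=
  Set.range fun j : Fin a => ∑ i ∈ Finset.Iic j, r i

/-- The multiset of all cycle lengths of a permutation, fixed points included. -/
def cycleLengths {n : ℕ} (π : Equiv.Perm (Fin n)) : Multiset ℕ :=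
  π.partition.parts

end GesselReutenauer

namespace GesselReutenauer

open Finset

/-! ### Monotone enumerations of multisets -/

/-! Put `τ = (st w)⁻¹`. The word `w ∘ τ` is the weakly increasing rearrangement `u` of `w`, so it
depends on the content only, and `w = u ∘ st w`. This gives the statement on `st`: on a block of
equal letters of `u` the permutation `τ` increases, so its descents can occur only at block ends,
which are partial sums; conversely, under this descent condition on `π⁻¹` the word `u ∘ π` has
standard permutation `π`.

For `U` it suffices to follow the cycles backwards (`ε = -1`); the other sense reverses every
necklace. Let `backward w x` be the infinite word of letters at `τ x, τ² x, …`. Since `w ∘ τ` is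
sorted and `τ` increases across equal letters, `x ↦ backward w x` is lexicographically monotone
(`monotone_backward`). These words are, with multiplicity, the periodic words read off the necklaces
of `U (-1) w` from all starting places, so they form the sorted list of the readings. Hence the
necklaces determine `backward w`, and with it `w`.

Conversely, given primitive necklaces, sort all their readings and let `w x` be the letter that
cyclically precedes the `x`-th reading (`exists_U_neg_one_eq`). Prepending that letter permutes the
readings, and `st w` describes this permutation, so the readings of `U (-1) w` are the given ones.
Primitive necklaces can be recovered from their readings (`eq_of_bind_readings_eq`). -/

theorem eq_of_monotone_of_map_eq {n : ℕ} {β : Type*} [LinearOrder β] {f g : Fin n → β}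
    (hf : Monotone f) (hg : Monotone g) (h : univ.val.map f = univ.val.map g) : f = g := by
  apply List.ofFn_injective
  refine List.Perm.eq_of_sortedLE hf.sortedLE_ofFn hg.sortedLE_ofFn ?_
  rw [← Multiset.coe_eq_coe]
  simpa [Fin.univ_val_map] using h

theorem exists_monotone_map_eq {n : ℕ} {β : Type*} [LinearOrder β] (K : Multiset β)
    (hK : Multiset.card K = n) : ∃ f : Fin n → β, Monotone f ∧ univ.val.map f = K := by
  subst hK
  have hl : (K.sort (· ≤ ·)).length = Multiset.card K := Multiset.length_sort ..
  refine ⟨fun i => (K.sort (· ≤ ·)).get (i.cast hl.symm), ?_, ?_⟩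
  · rw [← List.sortedLE_ofFn_iff]
    have : List.ofFn (fun i => (K.sort (· ≤ ·)).get (i.cast hl.symm)) = K.sort (· ≤ ·) := by
      apply List.ext_getElem <;> simp
    rw [this]
    exact (Multiset.pairwise_sort K (· ≤ ·)).sortedLE
  · rw [Fin.univ_val_map]
    have : List.ofFn (fun i => (K.sort (· ≤ ·)).get (i.cast hl.symm)) = K.sort (· ≤ ·) := by
      apply List.ext_getElem <;> simp
    rw [this, Multiset.sort_eq]

theorem map_univ_perm {n : ℕ} {β : Type*} (σ : Equiv.Perm (Fin n)) (f : Fin n → β) :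
    univ.val.map (fun i => f (σ i)) = univ.val.map f := by
  have h : univ.val.map σ = (univ : Finset (Fin n)).val := by
    simp
  conv_rhs => rw [← h, Multiset.map_map]
  rfl

theorem mem_wordsOfContent_iff {n a : ℕ} {r : Fin a → ℕ} {w : Fin n → Fin a} :
    w ∈ wordsOfContent n r ↔ ∀ i, (univ.val.map w).count i = r i := by
  refine forall_congr' fun i => ?_
  rw [Multiset.count_map, Finset.card_def, Finset.filter_val]
  simp only [eq_comm]

theorem map_eq_of_mem_wordsOfContent {n a : ℕ} {r : Fin a → ℕ} {w w' : Fin n → Fin a}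
    (hw : w ∈ wordsOfContent n r) (hw' : w' ∈ wordsOfContent n r) :
    univ.val.map w = univ.val.map w' := by
  ext i
  rw [mem_wordsOfContent_iff.1 hw, mem_wordsOfContent_iff.1 hw']

theorem comp_perm_mem_wordsOfContent {n a : ℕ} {r : Fin a → ℕ} {w : Fin n → Fin a}
    (σ : Equiv.Perm (Fin n)) (hw : w ∈ wordsOfContent n r) :
    (fun i => w (σ i)) ∈ wordsOfContent n r := by
  rw [mem_wordsOfContent_iff, map_univ_perm]
  exact mem_wordsOfContent_iff.1 hw

theorem exists_monotone_mem_wordsOfContent {n a : ℕ} {r : Fin a → ℕ} (hr : ∑ i, r i = n) :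
    ∃ u ∈ wordsOfContent n r, Monotone u := by
  obtain ⟨u, hu, h⟩ := exists_monotone_map_eq (n := n)
    (∑ i, Multiset.replicate (r i) i : Multiset (Fin a)) (by simpa using hr)
  refine ⟨u, mem_wordsOfContent_iff.2 fun i => ?_, hu⟩
  rw [h, Multiset.count_sum']
  simp [Multiset.count_replicate]

/-! ### The standard permutation -/

section Standard

variable {n : ℕ} {α : Type*} [LinearOrder α]

theorem before_or_before (w : Fin n → α) {i j : Fin n} (h : i ≠ j) :
    Before w i j ∨ Before w j i := by
  unfold Before
  rcases lt_trichotomy (w i) (w j) with h1 | h1 | h1 <;> rcases lt_or_gt_of_ne h with h2 | h2 <;>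
    simp [h1, h2]

theorem st_lt_iff (w : Fin n → α) {i j : Fin n} : st w i < st w j ↔ Before w i j := by
  have key : ∀ {i j}, Before w i j → st w i < st w j := fun h => rank_strict w h
  refine ⟨fun h => ?_, key⟩
  have hne : i ≠ j := by rintro rfl; exact lt_irrefl _ h
  exact (before_or_before w hne).resolve_right fun h' => lt_asymm h (key h')

theorem before_inv_st (w : Fin n → α) {i j : Fin n} (h : i < j) :
    Before w ((st w)⁻¹ i) ((st w)⁻¹ j) := by
  rw [← st_lt_iff]
  simpa using h

theorem monotone_comp_inv_st (w : Fin n → α) : Monotone fun i => w ((st w)⁻¹ i) := by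
  intro i j hij
  rcases hij.eq_or_lt with rfl | h
  · exact le_rfl
  · rcases before_inv_st w h with h | h
    · exact h.le
    · exact h.1.le

/-- The map `st w ∘ π⁻¹` is strictly increasing on `Fin n`, hence the identity. -/
theorem st_eq_of_forall_before {w : Fin n → α} {π : Equiv.Perm (Fin n)}
    (h : ∀ x y, π x < π y → Before w x y) : st w = π := by
  have h1 : (fun i => st w (π⁻¹ i)) = fun i => i := by
    refine eq_of_monotone_of_map_eq ?_ monotone_id ?_
    · refine StrictMono.monotone fun i j hij => (st_lt_iff w).2 (h _ _ ?_)
      simpa using hij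
    · exact map_univ_perm (π⁻¹.trans (st w)) fun i => i
  ext x
  have := congrFun h1 (π x)
  rw [show π⁻¹ (π x) = x from π.symm_apply_apply x] at this
  rw [this]

end Standard

/-- The `j`-th partial sum counts the letters that are at most `j`. -/
theorem sum_Iic_eq_card {n a : ℕ} {r : Fin a → ℕ} {w : Fin n → Fin a}
    (hw : w ∈ wordsOfContent n r) (j : Fin a) :
    ∑ i ∈ Iic j, r i = #{x | w x ≤ j} := by
  rw [card_eq_sum_card_fiberwise (f := w) (t := Iic j) (by intro x hx; simpa using hx)]
  refine sum_congr rfl fun i hi => ?_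
  rw [← hw i]
  congr 1
  ext x
  simp only [mem_filter, mem_univ, true_and]
  exact ⟨fun h => ⟨h ▸ mem_Iic.1 hi, h⟩, fun h => h.2⟩

theorem descentSet_inv_st_subset {n a : ℕ} {r : Fin a → ℕ} {w : Fin n → Fin a}
    (hw : w ∈ wordsOfContent n r) : descentSet (st w)⁻¹ ⊆ partialSums r := by
  rintro p ⟨i, rfl, hi⟩
  by_cases hn : (i : ℕ) + 1 = n
  · have ha : 0 < a := (w i).pos
    refine ⟨⟨a - 1, by omega⟩, ?_⟩
    change ∑ k ∈ Iic _, r k = _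
    rw [sum_Iic_eq_card hw, hn, filter_true_of_mem, card_univ, Fintype.card_fin]
    intro x _
    rw [Fin.le_def]
    change (w x : ℕ) ≤ a - 1
    omega
  · obtain ⟨h, hd⟩ := hi.resolve_left hn
    have hlt : w ((st w)⁻¹ i) < w ((st w)⁻¹ ⟨i + 1, h⟩) := by
      have hb := before_inv_st w (i := i) (j := ⟨i + 1, h⟩) (by simp [Fin.lt_def])
      exact hb.resolve_right fun h' => lt_asymm h'.2 hd
    -- The sorted word jumps right after position `i`, so exactly `i + 1` of its letters are at most
    -- the letter there.
    refine ⟨w ((st w)⁻¹ i), ?_⟩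
    change ∑ k ∈ Iic _, r k = _
    rw [sum_Iic_eq_card (comp_perm_mem_wordsOfContent (st w)⁻¹ hw), ← Fin.card_Iic]
    congr 1
    ext y
    simp only [mem_filter, mem_univ, true_and, mem_Iic]
    refine ⟨fun hy => ?_, fun hy => monotone_comp_inv_st w hy⟩
    by_contra hc
    have : (⟨i + 1, h⟩ : Fin n) ≤ y := by
      rw [Fin.le_def]; rw [not_le, Fin.lt_def] at hc; exact hc
    exact (hlt.trans_le (monotone_comp_inv_st w this)).not_ge hy

theorem not_mem_partialSums_of_eq {n a : ℕ} {r : Fin a → ℕ} {u : Fin n → Fin a}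
    (hu : u ∈ wordsOfContent n r) (hm : Monotone u) {k : ℕ} (hk : k + 1 < n)
    (h : u ⟨k, by omega⟩ = u ⟨k + 1, hk⟩) : k + 1 ∉ partialSums r := by
  rintro ⟨j, hj⟩
  change ∑ i ∈ Iic j, r i = _ at hj
  rw [sum_Iic_eq_card hu] at hj
  by_cases hj' : u ⟨k, by omega⟩ ≤ j
  · have hs : Iic (⟨k + 1, hk⟩ : Fin n) ⊆ ({x | u x ≤ j} : Finset (Fin n)) := by
      intro x hx
      simp only [mem_filter, mem_univ, true_and]
      exact (hm (mem_Iic.1 hx)).trans (h ▸ hj')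
    have := card_le_card hs
    rw [Fin.card_Iic] at this
    simp only at this
    omega
  · have hs : ({x | u x ≤ j} : Finset (Fin n)) ⊆ Iio (⟨k, by omega⟩ : Fin n) := by
      intro x hx
      simp only [mem_filter, mem_univ, true_and] at hx
      rw [mem_Iio]
      by_contra hc
      exact hj' ((hm (not_lt.1 hc)).trans hx)
    have := card_le_card hs
    rw [Fin.card_Iio] at this
    simp only at this
    omega

theorem bijOn_st {n a : ℕ} {r : Fin a → ℕ} (hr : ∑ i, r i = n) :
    Set.BijOn st (wordsOfContent n r)
      {π : Equiv.Perm (Fin n) | descentSet π⁻¹ ⊆ partialSums r} := by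
  refine ⟨fun w hw => descentSet_inv_st_subset hw, fun w hw w' hw' h => ?_, fun π hπ => ?_⟩
  · have h1 : (fun i => w ((st w)⁻¹ i)) = fun i => w' ((st w')⁻¹ i) :=
      eq_of_monotone_of_map_eq (monotone_comp_inv_st w) (monotone_comp_inv_st w')
        (map_eq_of_mem_wordsOfContent (comp_perm_mem_wordsOfContent _ hw)
          (comp_perm_mem_wordsOfContent _ hw'))
    funext x
    have := congrFun h1 (st w x)
    rwa [← h, show (st w)⁻¹ (st w x) = x from (st w).symm_apply_apply x] at this
  · obtain ⟨u, hu, hm⟩ := exists_monotone_mem_wordsOfContent hr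
    refine ⟨fun i => u (π i), comp_perm_mem_wordsOfContent π hu, ?_⟩
    -- On a block of equal letters of `u` no inner position is a partial sum, so `π⁻¹` has no
    -- descent there and increases along the block.
    have step : ∀ (d k : ℕ) (hk : k + d + 1 < n),
        u ⟨k, by omega⟩ = u ⟨k + d + 1, hk⟩ → π⁻¹ ⟨k, by omega⟩ < π⁻¹ ⟨k + d + 1, hk⟩ := by
      have one : ∀ (k : ℕ) (hk : k + 1 < n),
          u ⟨k, by omega⟩ = u ⟨k + 1, hk⟩ → π⁻¹ ⟨k, by omega⟩ < π⁻¹ ⟨k + 1, hk⟩ := by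
        intro k hk h
        by_contra hc
        refine not_mem_partialSums_of_eq hu hm hk h (hπ ⟨⟨k, by omega⟩, rfl, Or.inr ⟨hk, ?_⟩⟩)
        refine lt_of_le_of_ne (not_lt.1 hc) fun h' => ?_
        have := π⁻¹.injective h'
        simp at this
      intro d
      induction d with
      | zero => exact fun k hk h => one k hk h
      | succ d ih =>
        intro k hk h
        have h1 : u ⟨k, by omega⟩ ≤ u ⟨k + d + 1, by omega⟩ :=
          hm (by rw [Fin.mk_le_mk]; omega)
        have h2 : u ⟨k + d + 1, by omega⟩ ≤ u ⟨k + (d + 1) + 1, hk⟩ :=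
          hm (by rw [Fin.mk_le_mk]; omega)
        have h3 := h1.antisymm (h2.trans h.ge)
        exact (ih k (by omega) h3).trans (one (k + d + 1) hk (h3.symm.trans h))
    refine st_eq_of_forall_before fun x y hxy => ?_
    rcases (hm hxy.le).lt_or_eq with h | h
    · exact Or.inl h
    · refine Or.inr ⟨h, ?_⟩
      obtain ⟨d, hd⟩ := Nat.exists_eq_add_of_lt (Fin.lt_def.1 hxy)
      have hy : π y = ⟨(π x : ℕ) + d + 1, hd ▸ (π y).2⟩ := Fin.ext hd
      have := step d (π x) (hd ▸ (π y).2) (by rw [← hy]; exact h)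
      rw [← hy] at this
      simpa using this

/-! ### Periodic words and primitive necklaces -/

/-- Removal of the first letter of an infinite word. -/
def shift {α : Type*} (v : ℕ → α) : ℕ → α := fun k => v (k + 1)

theorem shift_iterate {α : Type*} (m : ℕ) (v : ℕ → α) : shift^[m] v = fun k => v (k + m) := by
  induction m generalizing v with
  | zero => rfl
  | succ m ih =>
    rw [Function.iterate_succ_apply, ih]
    funext k
    simp [shift, add_assoc, add_comm m]

section Periodic

variable {α : Type*}

theorem coe_cyclicPermutations {l : List α} (hl : l ≠ []) :
    (l.cyclicPermutations : Multiset (List α)) = (Multiset.range l.length).map l.rotate := by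
  rw [Multiset.range, Multiset.map_coe]
  congr 1
  apply List.ext_getElem
  · simp [List.length_cyclicPermutations_of_ne_nil, hl]
  · simp [List.getElem_cyclicPermutations]

theorem IsPrimitive.ne_nil {c : Cycle α} (hc : IsPrimitive c) : c ≠ Cycle.nil := by
  rintro rfl
  exact (hc [] rfl).1 rfl

theorem isPrimitive_coe {l : List α} (h0 : l ≠ [])
    (h : ∀ k, 0 < k → k < l.length → l.rotate k ≠ l) : IsPrimitive (l : Cycle α) := by
  intro l' hl'
  obtain ⟨m, rfl⟩ := (Cycle.coe_eq_coe.1 hl').symm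
  refine ⟨by simpa using h0, fun k hk hk' he => h k hk (by simpa using hk') ?_⟩
  apply List.rotate_injective m
  change (l.rotate k).rotate m = l.rotate m
  rw [List.rotate_rotate] at he ⊢
  rwa [add_comm]

variable [Inhabited α]

/-- The infinite word `l l l …`. -/
def periodicWord (l : List α) : ℕ → α := fun k => l.getD (k % l.length) default

theorem periodicWord_of_lt {l : List α} {k : ℕ} (h : k < l.length) : periodicWord l k = l[k] := by
  simp [periodicWord, Nat.mod_eq_of_lt h, h]

theorem periodicWord_rotate (l : List α) (i : ℕ) :
    periodicWord (l.rotate i) = shift^[i] (periodicWord l) := by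
  rw [shift_iterate]
  funext k
  rcases Nat.eq_zero_or_pos l.length with h | h
  · rw [List.length_eq_zero_iff] at h
    simp [h, periodicWord]
  · have h1 : k % l.length < l.length := Nat.mod_lt _ h
    have h2 : (k + i) % l.length < l.length := Nat.mod_lt _ h
    simp [periodicWord, h1, h2, List.getElem_rotate]

theorem eq_of_periodicWord_eq {l l' : List α} (hl : l.length = l'.length)
    (h : periodicWord l = periodicWord l') : l = l' := by
  refine List.ext_getElem hl fun k h1 h2 => ?_
  rw [← periodicWord_of_lt h1, ← periodicWord_of_lt h2, h]

theorem isPeriodicPt_periodicWord (l : List α) :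
    Function.IsPeriodicPt shift l.length (periodicWord l) := by
  change shift^[l.length] _ = _
  rw [← periodicWord_rotate, List.rotate_length]

/-- A shorter period of the infinite word would be a nontrivial rotation fixing `l`. Thus the
infinite word remembers the length of a primitive `l`, hence `l` itself. -/
theorem minimalPeriod_periodicWord {l : List α} (hl : IsPrimitive (l : Cycle α)) :
    Function.minimalPeriod shift (periodicWord l) = l.length := by
  obtain ⟨h0, h⟩ := hl l rfl
  have hp : 0 < l.length := List.length_pos_iff.2 h0
  have hle := (isPeriodicPt_periodicWord l).minimalPeriod_le hp
  refine hle.eq_of_not_lt fun hlt =>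
    h _ ((isPeriodicPt_periodicWord l).minimalPeriod_pos hp) hlt ?_
  refine eq_of_periodicWord_eq (List.length_rotate ..) ?_
  rw [periodicWord_rotate]
  exact Function.isPeriodicPt_minimalPeriod _ _

theorem eq_of_periodicWord_eq_of_isPrimitive {l l' : List α} (hl : IsPrimitive (l : Cycle α))
    (hl' : IsPrimitive (l' : Cycle α)) (h : periodicWord l = periodicWord l') : l = l' :=
  eq_of_periodicWord_eq
    (by rw [← minimalPeriod_periodicWord hl, ← minimalPeriod_periodicWord hl', h]) h

/-- The infinite words obtained by reading a necklace from each of its positions. -/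
def readings (c : Cycle α) : Multiset (ℕ → α) := c.lists.map periodicWord

theorem readings_coe {l : List α} (hl : l ≠ []) :
    readings (l : Cycle α) =
      (Multiset.range l.length).map fun i => shift^[i] (periodicWord l) := by
  rw [readings, Cycle.lists_coe, coe_cyclicPermutations hl, Multiset.map_map]
  simp [periodicWord_rotate]

theorem map_shift_readings {c : Cycle α} (hc : c ≠ Cycle.nil) :
    (readings c).map shift = readings c := by
  induction c using Quotient.inductionOn' with | h l => ?_
  change (readings (l : Cycle α)).map shift = readings (l : Cycle α)
  have hl : l ≠ [] := by rintro rfl; exact hc rfl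
  rw [readings_coe hl, Multiset.map_map]
  have h0 : shift^[l.length] (periodicWord l) = shift^[0] (periodicWord l) :=
    isPeriodicPt_periodicWord l
  -- Among the shifts by `0, …, l.length` the first and the last agree. Dropping the last leaves the
  -- readings, dropping the first leaves their shifts.
  have h1 : (Multiset.range (l.length + 1)).map (fun i => shift^[i] (periodicWord l)) =
      shift^[0] (periodicWord l) ::ₘ
        (Multiset.range l.length).map (shift ∘ fun i => shift^[i] (periodicWord l)) := by
    simp only [Multiset.range, List.range_succ_eq_map, Multiset.map_coe, List.map_cons,
      List.map_map, Multiset.cons_coe]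
    congr 3
    funext i
    simp only [Function.comp_apply, Function.iterate_succ_apply']
  rw [Multiset.range_succ, Multiset.map_cons, h0] at h1
  exact ((Multiset.cons_inj_right _).1 h1).symm

theorem card_readings {c : Cycle α} (hc : c ≠ Cycle.nil) :
    Multiset.card (readings c) = c.length := by
  induction c using Quotient.inductionOn' with | h l => ?_
  change Multiset.card (readings (l : Cycle α)) = (l : Cycle α).length
  have hl : l ≠ [] := by rintro rfl; exact hc rfl
  simp [readings_coe hl]

theorem nodup_readings {c : Cycle α} (hc : IsPrimitive c) : (readings c).Nodup := by
  induction c using Quotient.inductionOn' with | h l => ?_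
  change IsPrimitive (l : Cycle α) at hc
  change (readings (l : Cycle α)).Nodup
  rw [readings_coe (hc l rfl).1]
  refine (Multiset.nodup_map_iff_inj_on (Multiset.nodup_range _)).2 fun i hi j hj h => ?_
  rw [Multiset.mem_range] at hi hj
  rw [← minimalPeriod_periodicWord hc] at hi hj
  exact Function.iterate_injOn_Iio_minimalPeriod hi hj h

theorem eq_of_mem_readings {c c' : Cycle α} (hc : IsPrimitive c) (hc' : IsPrimitive c')
    {v : ℕ → α} (h : v ∈ readings c) (h' : v ∈ readings c') : c = c' := by
  obtain ⟨l, hl, rfl⟩ := Multiset.mem_map.1 h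
  obtain ⟨l', hl', he⟩ := Multiset.mem_map.1 h'
  rw [Cycle.mem_lists_iff_coe_eq] at hl hl'
  subst hl hl'
  rw [eq_of_periodicWord_eq_of_isPrimitive hc' hc he]

theorem exists_mem_readings (c : Cycle α) : ∃ v, v ∈ readings c := by
  induction c using Quotient.inductionOn' with | h l => ?_
  exact ⟨periodicWord l, Multiset.mem_map_of_mem _ (Cycle.mem_lists_iff_coe_eq.2 rfl)⟩

open Classical in
-- A primitive necklace has each of its readings once and shares none with another primitive
-- necklace, so the multiplicity of one reading is that of its necklace.
theorem count_bind_readings {M : Multiset (Cycle α)} (hM : ∀ c ∈ M, IsPrimitive c)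
    {c : Cycle α} (hc : IsPrimitive c) {v : ℕ → α} (hv : v ∈ readings c) :
    (M.bind readings).count v = M.count c := by
  induction M using Multiset.induction_on with
  | empty => simp
  | cons d M ih =>
    rw [Multiset.cons_bind, Multiset.count_add, ih fun e he => hM e (Multiset.mem_cons_of_mem he),
      Multiset.count_cons, add_comm]
    congr 1
    have hd := hM d (Multiset.mem_cons_self d M)
    split_ifs with h
    · subst h
      exact Multiset.count_eq_one_of_mem (nodup_readings hd) hv
    · exact Multiset.count_eq_zero_of_notMem fun h' => h (eq_of_mem_readings hc hd hv h')

/-- A multiset of primitive necklaces is determined by its readings. -/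
theorem eq_of_bind_readings_eq {M M' : Multiset (Cycle α)} (hM : ∀ c ∈ M, IsPrimitive c)
    (hM' : ∀ c ∈ M', IsPrimitive c) (h : M.bind readings = M'.bind readings) : M = M' := by
  classical
  ext c
  by_cases hc : IsPrimitive c
  · obtain ⟨v, hv⟩ := exists_mem_readings c
    rw [← count_bind_readings hM hc hv, h, count_bind_readings hM' hc hv]
  · rw [Multiset.count_eq_zero_of_notMem fun h => hc (hM c h),
      Multiset.count_eq_zero_of_notMem fun h => hc (hM' c h)]

end Periodic

/-! ### Cycles of a permutation -/

section Cycles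

variable {n : ℕ} (τ : Equiv.Perm (Fin n))

theorem cycleThrough_eq_periodicOrbit (x : Fin n) :
    cycleThrough τ x = Function.periodicOrbit τ x := by
  simp [cycleThrough, Function.periodicOrbit, Equiv.Perm.iterate_eq_pow]

theorem mem_periodicPts (x : Fin n) : x ∈ Function.periodicPts τ :=
  Function.Injective.mem_periodicPts τ.injective x

theorem minimalPeriod_perm_pos (x : Fin n) : 0 < Function.minimalPeriod τ x :=
  Function.minimalPeriod_pos_of_mem_periodicPts (mem_periodicPts τ x)

theorem cycleThrough_pow_apply (k : ℕ) (x : Fin n) :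
    cycleThrough τ ((τ ^ k) x) = cycleThrough τ x := by
  rw [cycleThrough_eq_periodicOrbit, cycleThrough_eq_periodicOrbit, ← Equiv.Perm.iterate_eq_pow,
    Function.periodicOrbit_apply_iterate_eq (mem_periodicPts τ x)]

theorem mem_cycleThrough_iff {x y : Fin n} :
    y ∈ cycleThrough τ x ↔ cycleThrough τ x = cycleThrough τ y := by
  refine ⟨fun h => ?_, fun h => ?_⟩
  · rw [cycleThrough_eq_periodicOrbit,
      Function.mem_periodicOrbit_iff (mem_periodicPts τ x)] at h
    obtain ⟨k, rfl⟩ := h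
    rw [Equiv.Perm.iterate_eq_pow, cycleThrough_pow_apply]
  · rw [h, cycleThrough_eq_periodicOrbit]
    exact Function.self_mem_periodicOrbit (mem_periodicPts τ y)

theorem mem_cycleThrough_iff_sameCycle {x y : Fin n} :
    y ∈ cycleThrough τ x ↔ τ.SameCycle x y := by
  rw [cycleThrough_eq_periodicOrbit, Function.mem_periodicOrbit_iff (mem_periodicPts τ x)]
  refine ⟨fun ⟨k, hk⟩ => ⟨k, by simpa [Equiv.Perm.iterate_eq_pow] using hk⟩, fun h => ?_⟩
  obtain ⟨k, hk⟩ := h.exists_nat_pow_eq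
  exact ⟨k, by rw [Equiv.Perm.iterate_eq_pow, hk]⟩

theorem length_cycleThrough (x : Fin n) :
    (cycleThrough τ x).length = Function.minimalPeriod τ x := by
  rw [cycleThrough_eq_periodicOrbit, Function.periodicOrbit_length]

theorem nodup_toMultiset_cycleThrough (x : Fin n) : (cycleThrough τ x).toMultiset.Nodup := by
  have h := Function.nodup_periodicOrbit (f := τ) (x := x)
  rw [← cycleThrough_eq_periodicOrbit] at h
  exact h

theorem mem_toMultiset_iff {α : Type*} {c : Cycle α} {x : α} : x ∈ c.toMultiset ↔ x ∈ c := by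
  induction c using Quotient.inductionOn' with | h l => rfl

/-- Every point lies on exactly one cycle. -/
theorem bind_toMultiset_cycles :
    (cycles τ).val.bind Cycle.toMultiset = (univ : Finset (Fin n)).val := by
  ext x
  rw [Multiset.count_bind, Multiset.count_eq_one_of_mem univ.nodup (mem_univ x)]
  change ∑ c ∈ cycles τ, c.toMultiset.count x = 1
  rw [sum_eq_single (cycleThrough τ x)]
  · exact Multiset.count_eq_one_of_mem (nodup_toMultiset_cycleThrough τ x)
      (mem_toMultiset_iff.2 ((mem_cycleThrough_iff τ).2 rfl))
  · intro c hc hne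
    obtain ⟨y, -, rfl⟩ := mem_image.1 hc
    exact Multiset.count_eq_zero_of_notMem fun h =>
      hne ((mem_cycleThrough_iff τ).1 (mem_toMultiset_iff.1 h))
  · exact fun h => absurd (mem_image_of_mem _ (mem_univ x)) h

/-- Two maps with the same fibres have equivalent images. -/
theorem map_image_val_eq {ι β γ δ : Type*} [DecidableEq ι] [DecidableEq β] [DecidableEq γ]
    (s : Finset ι) (f : ι → β) (g : ι → γ) (h : β → δ) (k : γ → δ)
    (hfg : ∀ x ∈ s, ∀ y ∈ s, f x = f y ↔ g x = g y) (hk : ∀ x ∈ s, h (f x) = k (g x)) :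
    (s.image f).val.map h = (s.image g).val.map k := by
  induction s using Finset.induction_on with
  | empty => simp
  | insert x s hx ih =>
    have ih' := ih (fun y hy z hz => hfg y (mem_insert_of_mem hy) z (mem_insert_of_mem hz))
      fun y hy => hk y (mem_insert_of_mem hy)
    rw [image_insert, image_insert]
    have hiff : f x ∈ s.image f ↔ g x ∈ s.image g := by
      simp only [mem_image]
      exact exists_congr fun y => and_congr_right fun hy =>
        hfg y (mem_insert_of_mem hy) x (mem_insert_self x s)
    by_cases hm : f x ∈ s.image f
    · rw [insert_eq_of_mem hm, insert_eq_of_mem (hiff.1 hm), ih']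
    · rw [insert_val_of_notMem hm, insert_val_of_notMem (mt hiff.2 hm), Multiset.map_cons,
        Multiset.map_cons, ih', hk x (mem_insert_self x s)]

theorem cycleFactorsFinset_eq_image_cycleOf :
    τ.cycleFactorsFinset = τ.support.image τ.cycleOf := by
  ext g
  rw [mem_image]
  constructor
  · intro hg
    obtain ⟨x, hx⟩ := (Equiv.Perm.mem_cycleFactorsFinset_iff.1 hg).1.nonempty_support
    exact ⟨x, Equiv.Perm.mem_cycleFactorsFinset_support_le hg hx,
      (Equiv.Perm.cycle_is_cycleOf hx hg).symm⟩
  · rintro ⟨x, hx, rfl⟩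
    exact Equiv.Perm.cycleOf_mem_cycleFactorsFinset_iff.2 hx

theorem card_support_cycleOf {x : Fin n} (hx : x ∈ τ.support) :
    #(τ.cycleOf x).support = (cycleThrough τ x).length := by
  rw [← Cycle.card_toMultiset, ← Multiset.toFinset_card_of_nodup
    (nodup_toMultiset_cycleThrough τ x)]
  congr 1
  ext y
  rw [Multiset.mem_toFinset, mem_toMultiset_iff, mem_cycleThrough_iff_sameCycle,
    Equiv.Perm.mem_support_cycleOf_iff' (Equiv.Perm.mem_support.1 hx)]

/-- `Equiv.Perm.partition` collects the nontrivial cycle factors and one part `1` per fixed point,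
so the cycles inside and outside the support are compared separately. -/
theorem map_length_cycles : (cycles τ).val.map Cycle.length = cycleLengths τ := by
  rw [cycleLengths, Equiv.Perm.parts_partition, Equiv.Perm.cycleType_def,
    cycleFactorsFinset_eq_image_cycleOf]
  have hsplit : cycles τ =
      τ.support.image (cycleThrough τ) ∪ τ.supportᶜ.image (cycleThrough τ) := by
    rw [← image_union, union_compl, cycles]
  have hfix : ∀ x ∈ τ.supportᶜ, (cycleThrough τ x).length = 1 := by
    intro x hx
    rw [length_cycleThrough, Function.minimalPeriod_eq_one_iff_isFixedPt]
    exact Equiv.Perm.notMem_support.1 (mem_compl.1 hx)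
  have hdisj : Disjoint (τ.support.image (cycleThrough τ))
      (τ.supportᶜ.image (cycleThrough τ)) := by
    rw [disjoint_left]
    rintro c hc hc'
    obtain ⟨x, hx, rfl⟩ := mem_image.1 hc
    obtain ⟨y, hy, hxy⟩ := mem_image.1 hc'
    have h1 := hfix y hy
    rw [hxy, length_cycleThrough, Function.minimalPeriod_eq_one_iff_isFixedPt] at h1
    exact Equiv.Perm.mem_support.1 hx h1
  have hinj : Set.InjOn (cycleThrough τ) (τ.supportᶜ : Finset (Fin n)) := by
    intro x hx y hy h
    obtain ⟨k, rfl⟩ := (mem_cycleThrough_iff_sameCycle τ).1 ((mem_cycleThrough_iff τ).2 h)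
    refine (Equiv.Perm.zpow_apply_eq_self_of_apply_eq_self ?_ k).symm
    simpa using hx
  rw [hsplit, ← disjUnion_eq_union _ _ hdisj, disjUnion_val, Multiset.map_add]
  congr 1
  · refine map_image_val_eq _ _ _ _ _ (fun x hx y hy => ?_) fun x hx =>
      (card_support_cycleOf τ hx).symm
    rw [← mem_cycleThrough_iff, mem_cycleThrough_iff_sameCycle,
      Equiv.Perm.sameCycle_iff_cycleOf_eq_of_mem_support hx hy]
  · rw [image_val_of_injOn hinj, Multiset.map_map, Multiset.eq_replicate]
    refine ⟨by simp [card_compl], fun b hb => ?_⟩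
    obtain ⟨x, hx, rfl⟩ := Multiset.mem_map.1 hb
    exact hfix x hx

theorem cycleLengths_inv : cycleLengths τ⁻¹ = cycleLengths τ := by
  rw [cycleLengths, cycleLengths, Equiv.Perm.parts_partition, Equiv.Perm.parts_partition,
    Equiv.Perm.cycleType_inv, Equiv.Perm.support_inv]

theorem minimalPeriod_inv (x : Fin n) :
    Function.minimalPeriod (τ⁻¹ : Equiv.Perm (Fin n)) x = Function.minimalPeriod τ x := by
  rw [Function.minimalPeriod_eq_minimalPeriod_iff]
  intro k
  simp only [Function.IsPeriodicPt, Function.IsFixedPt, Equiv.Perm.iterate_eq_pow, inv_pow]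
  rw [Equiv.Perm.inv_eq_iff_eq, eq_comm]

theorem cycleThrough_inv (x : Fin n) : cycleThrough τ⁻¹ x = (cycleThrough τ x).reverse := by
  -- Starting at `τ⁻¹ x` instead of `x` makes the two lists exact reverses of each other, with no
  -- rotation left over.
  have hx : cycleThrough τ⁻¹ x = cycleThrough τ⁻¹ (τ⁻¹ x) := by
    simpa using (cycleThrough_pow_apply τ⁻¹ 1 x).symm
  rw [hx, cycleThrough, cycleThrough, Cycle.reverse_coe]
  have hp : Function.minimalPeriod (τ⁻¹ : Equiv.Perm (Fin n)) (τ⁻¹ x) =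
      Function.minimalPeriod τ x := by
    rw [Function.minimalPeriod_apply (mem_periodicPts τ⁻¹ x), minimalPeriod_inv]
  rw [hp]
  congr 1
  refine List.ext_getElem (by simp) fun k h1 h2 => ?_
  simp only [List.length_map, List.length_range] at h1
  simp only [List.getElem_map, List.getElem_range, List.getElem_reverse, List.length_map,
    List.length_range]
  rw [← Equiv.Perm.mul_apply, ← pow_succ, inv_pow, Equiv.Perm.inv_eq_iff_eq,
    ← Equiv.Perm.mul_apply, ← pow_add,
    show k + 1 + (Function.minimalPeriod τ x - 1 - k) = Function.minimalPeriod τ x by omega,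
    ← Equiv.Perm.iterate_eq_pow, Function.iterate_minimalPeriod]

theorem cycles_inv : (cycles τ⁻¹).val = (cycles τ).val.map Cycle.reverse := by
  have h : cycles τ⁻¹ = (cycles τ).image Cycle.reverse := by
    rw [cycles, cycles, image_image]
    exact image_congr fun x _ => cycleThrough_inv τ x
  rw [h]
  exact image_val_of_injOn (fun c _ d _ h => by
    rw [← Cycle.reverse_reverse c, h, Cycle.reverse_reverse])

section Words

variable {α : Type*} (w : Fin n → α)

theorem map_cycleThrough (x : Fin n) :
    Cycle.map w (cycleThrough τ x) =
      (((List.range (Function.minimalPeriod τ x)).map fun k => w ((τ ^ k) x) : List α) :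
        Cycle α) := by
  rw [cycleThrough, Cycle.map_coe, List.map_map]
  rfl

theorem toMultiset_map {β : Type*} (f : α → β) (c : Cycle α) :
    (c.map f).toMultiset = c.toMultiset.map f := by
  induction c using Quotient.inductionOn' with | h l => rfl

theorem bind_toMultiset_map_cycles :
    ((cycles τ).val.map (Cycle.map w)).bind Cycle.toMultiset = univ.val.map w := by
  rw [Multiset.bind_map, ← bind_toMultiset_cycles τ, Multiset.map_bind]
  simp only [toMultiset_map]

variable [Inhabited α]

theorem periodicWord_map_range (x : Fin n) :
    periodicWord ((List.range (Function.minimalPeriod τ x)).map fun k => w ((τ ^ k) x)) =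
      fun k => w ((τ ^ k) x) := by
  funext k
  have h : k % Function.minimalPeriod τ x < Function.minimalPeriod τ x :=
    Nat.mod_lt _ (minimalPeriod_perm_pos τ x)
  simp only [periodicWord, List.length_map, List.length_range]
  rw [List.getD_eq_getElem _ _ (by simpa using h)]
  simp only [List.getElem_map, List.getElem_range]
  rw [← Equiv.Perm.iterate_eq_pow, Function.iterate_mod_minimalPeriod_eq,
    Equiv.Perm.iterate_eq_pow]

theorem readings_map_cycleThrough (x : Fin n) :
    readings (Cycle.map w (cycleThrough τ x)) =
      (cycleThrough τ x).toMultiset.map fun y k => w ((τ ^ k) y) := by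
  have hne : (List.range (Function.minimalPeriod τ x)).map (fun k => w ((τ ^ k) x)) ≠ [] := by
    simpa using (minimalPeriod_perm_pos τ x).ne'
  rw [map_cycleThrough, readings_coe hne, periodicWord_map_range, cycleThrough,
    Cycle.coe_toMultiset, Multiset.map_coe, List.map_map, List.length_map, List.length_range,
    Multiset.range, Multiset.map_coe]
  congr 2
  funext i
  rw [shift_iterate]
  funext k
  simp [pow_add]

theorem bind_readings_map_cycles :
    ((cycles τ).val.map (Cycle.map w)).bind readings =
      univ.val.map fun y k => w ((τ ^ k) y) := by
  rw [Multiset.bind_map, ← bind_toMultiset_cycles τ, Multiset.map_bind]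
  refine Multiset.bind_congr fun c hc => ?_
  obtain ⟨x, -, rfl⟩ := mem_image.1 (mem_def.2 hc)
  exact readings_map_cycleThrough τ w x

end Words

/-- If distinct points of a cycle read distinct words, the necklace is primitive. -/
theorem isPrimitive_map_cycleThrough {α : Type*} (w : Fin n → α) (x : Fin n)
    (h : ∀ y, (∀ k, w ((τ ^ k) y) = w ((τ ^ k) x)) → y ∈ cycleThrough τ x → y = x) :
    IsPrimitive (Cycle.map w (cycleThrough τ x)) := by
  have : Inhabited α := ⟨w x⟩
  rw [map_cycleThrough]
  refine isPrimitive_coe (by simpa using (minimalPeriod_perm_pos τ x).ne') fun k hk hk' he => ?_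
  rw [List.length_map, List.length_range] at hk'
  have h1 := congrArg periodicWord he
  rw [periodicWord_rotate, periodicWord_map_range, shift_iterate] at h1
  have h2 : (τ ^ k) x = x := by
    refine h _ (fun j => ?_) ((mem_cycleThrough_iff τ).2 (cycleThrough_pow_apply τ k x).symm)
    rw [← Equiv.Perm.mul_apply, ← pow_add]
    exact congrFun h1 j
  rw [← Equiv.Perm.iterate_eq_pow] at h2
  exact Function.not_isPeriodicPt_of_pos_of_lt_minimalPeriod hk.ne' hk' h2

end Cycles

/-! ### Backward readings of a word along its standard permutation -/

section Backward

variable {n : ℕ} {α : Type*} [LinearOrder α]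

/-- The letters met when the standard permutation of `w` is followed backwards from position `x`,
the letter at `x` itself left out. -/
noncomputable def backward (w : Fin n → α) (x : Fin n) : ℕ → α :=
  fun k => w (((st w)⁻¹ ^ (k + 1)) x)

/-- Ties between equal letters are broken by position, so each backward step that meets equal
letters keeps the order of the two positions. -/
theorem inv_st_pow_lt (w : Fin n → α) {x y : Fin n} (hxy : x < y) (k : ℕ)
    (h : ∀ j < k, backward w x j = backward w y j) :
    ((st w)⁻¹ ^ k) x < ((st w)⁻¹ ^ k) y := by
  induction k with
  | zero => simpa using hxy
  | succ k ih =>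
    have hb := before_inv_st w (ih fun j hj => h j (hj.trans k.lt_succ_self))
    rw [← Equiv.Perm.mul_apply, ← Equiv.Perm.mul_apply, ← pow_succ'] at hb
    rcases hb with hb | hb
    · exact absurd (h k k.lt_succ_self) hb.ne
    · exact hb.2

/-- Up to the first difference the order of the positions persists; there the sortedness of `w ∘ (st
w)⁻¹` decides in favour of the larger position. -/
theorem monotone_backward (w : Fin n → α) : Monotone fun x => toLex (backward w x) := by
  intro x y hxy
  rcases hxy.eq_or_lt with rfl | hlt
  · exact le_rfl
  refine not_lt.1 ?_
  rintro ⟨k, hk, hk'⟩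
  have hb := before_inv_st w (inv_st_pow_lt w hlt k fun j hj => (hk j hj).symm)
  rw [← Equiv.Perm.mul_apply, ← Equiv.Perm.mul_apply, ← pow_succ'] at hb
  have hle : backward w x k ≤ backward w y k := hb.elim le_of_lt fun h => h.1.le
  exact hle.not_gt hk'

theorem eq_of_backward_eq {w w' : Fin n → α} (h : backward w = backward w') : w = w' := by
  funext x
  -- The exponent `n!` kills every permutation of `Fin n`, so the index `n! - 1` reads the letter at
  -- `x` itself, for all words at once.
  have hw : ∀ w : Fin n → α, backward w x (n.factorial - 1) = w x := by
    intro w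
    have h1 : (st w)⁻¹ ^ n.factorial = 1 := by
      simpa [Fintype.card_perm] using pow_card_eq_one (x := (st w)⁻¹)
    rw [backward, Nat.sub_add_cancel n.factorial_pos, h1, Equiv.Perm.one_apply]
  rw [← hw w, ← hw w', h]

/-- A point and an iterate of it have different backward readings unless they coincide. -/
theorem inv_st_pow_eq_of_forall_eq (w : Fin n → α) {x : Fin n} {m : ℕ}
    (h : ∀ k, w (((st w)⁻¹ ^ k) (((st w)⁻¹ ^ m) x)) = w (((st w)⁻¹ ^ k) x)) :
    ((st w)⁻¹ ^ m) x = x := by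
  set τ := (st w)⁻¹ with hτ
  have hback : backward w ((τ ^ m) x) = backward w x := funext fun k => h (k + 1)
  have hper : ((τ ^ m) ^ n.factorial) x = x := by
    have : (τ ^ m) ^ n.factorial = 1 := by
      simpa [Fintype.card_perm] using pow_card_eq_one (x := τ ^ m)
    rw [this, Equiv.Perm.one_apply]
  -- Equal readings preserve the order under powers of `τ`, so a strict inequality would propagate
  -- to an infinite strictly monotone orbit of `τ ^ m`, which returns to `x` after `n!` steps.
  rcases lt_trichotomy ((τ ^ m) x) x with hlt | heq | hgt
  · have hanti : StrictAnti fun j => ((τ ^ m) ^ j) x := strictAnti_nat_of_succ_lt fun j => by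
      have := inv_st_pow_lt w hlt (m * j) fun i _ => congrFun hback i
      rwa [← hτ, ← Equiv.Perm.mul_apply, pow_mul, ← pow_succ] at this
    have := hanti n.factorial_pos
    simp only [hper, pow_zero, Equiv.Perm.one_apply] at this
    exact absurd this (lt_irrefl x)
  · exact heq
  · have hmono : StrictMono fun j => ((τ ^ m) ^ j) x := strictMono_nat_of_lt_succ fun j => by
      have := inv_st_pow_lt w hgt (m * j) fun i _ => (congrFun hback i).symm
      rwa [← hτ, ← Equiv.Perm.mul_apply, pow_mul, ← pow_succ] at this
    have := hmono n.factorial_pos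
    simp only [hper, pow_zero, Equiv.Perm.one_apply] at this
    exact absurd this (lt_irrefl x)

theorem U_neg_one (w : Fin n → α) :
    U (-1) w = (cycles (st w)⁻¹).val.map (Cycle.map w) := by
  simp [U]

theorem U_one (w : Fin n → α) : U 1 w = (U (-1) w).map Cycle.reverse := by
  have h : (cycles (st w)).val = (cycles (st w)⁻¹).val.map Cycle.reverse := by
    simpa using cycles_inv (st w)⁻¹
  rw [U_neg_one]
  simp only [U, Units.val_one, zpow_one, h, Multiset.map_map]
  refine Multiset.map_congr rfl fun c _ => ?_
  induction c using Quotient.inductionOn' with | h l => ?_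
  exact congrArg _ List.map_reverse

theorem isPrimitive_of_mem_U_neg_one (w : Fin n → α) {c : Cycle α} (hc : c ∈ U (-1) w) :
    IsPrimitive c := by
  rw [U_neg_one] at hc
  obtain ⟨d, hd, rfl⟩ := Multiset.mem_map.1 hc
  obtain ⟨x, -, rfl⟩ := mem_image.1 (mem_def.2 hd)
  refine isPrimitive_map_cycleThrough _ w x fun y h hy => ?_
  rw [cycleThrough_eq_periodicOrbit, Function.mem_periodicOrbit_iff (mem_periodicPts _ x)] at hy
  obtain ⟨m, rfl⟩ := hy
  rw [Equiv.Perm.iterate_eq_pow] at h ⊢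
  exact inv_st_pow_eq_of_forall_eq w h

theorem bind_toMultiset_U_neg_one (w : Fin n → α) :
    (U (-1) w).bind Cycle.toMultiset = univ.val.map w := by
  rw [U_neg_one, bind_toMultiset_map_cycles]

theorem bind_readings_U_neg_one [Inhabited α] (w : Fin n → α) :
    (U (-1) w).bind readings = univ.val.map (backward w) := by
  rw [U_neg_one, bind_readings_map_cycles, ← map_univ_perm (st w)⁻¹]
  refine Multiset.map_congr rfl fun x _ => funext fun k => ?_
  rw [backward, pow_succ, Equiv.Perm.mul_apply]

theorem U_neg_one_injective [Inhabited α] :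
    Function.Injective (U (-1) : (Fin n → α) → Multiset (Cycle α)) := by
  intro w w' h
  apply eq_of_backward_eq
  have h1 := congrArg (fun M => (M.bind readings).map toLex) h
  simp only [bind_readings_U_neg_one, Multiset.map_map] at h1
  have h2 := eq_of_monotone_of_map_eq (monotone_backward w) (monotone_backward w') h1
  exact funext fun x => toLex.injective (congrFun h2 x)

end Backward

/-! ### Reconstruction of a word from its necklaces -/

section Reconstruction

variable {α : Type*} [LinearOrder α]

theorem toLex_lt_of_head_lt {u v : ℕ → α} (h : u 0 < v 0) : toLex u < toLex v :=
  ⟨0, fun j hj => absurd hj (Nat.not_lt_zero j), h⟩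

theorem toLex_le_of_head_eq {u v : ℕ → α} (h : u 0 = v 0)
    (hs : toLex (shift u) ≤ toLex (shift v)) : toLex u ≤ toLex v := by
  refine not_lt.1 ?_
  rintro ⟨k, hk, hk'⟩
  cases k with
  | zero => exact hk'.ne h.symm
  | succ k => exact hs.not_gt ⟨k, fun j hj => hk (j + 1) (Nat.succ_lt_succ hj), hk'⟩

theorem exists_U_neg_one_eq [Inhabited α] {n : ℕ} {M : Multiset (Cycle α)}
    (hM : ∀ c ∈ M, IsPrimitive c) (hn : Multiset.card (M.bind Cycle.toMultiset) = n) :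
    ∃ w : Fin n → α, U (-1) w = M := by
  set K := M.bind readings with hK
  have hcard : Multiset.card K = n := by
    rw [← hn, hK, Multiset.card_bind, Multiset.card_bind]
    congr 1
    refine Multiset.map_congr rfl fun c hc => ?_
    rw [Function.comp_apply, Function.comp_apply, card_readings (hM c hc).ne_nil,
      Cycle.card_toMultiset]
  have hshift : K.map shift = K := by
    rw [hK, Multiset.map_bind]
    exact Multiset.bind_congr fun c hc => map_shift_readings (hM c hc).ne_nil
  have hiter : ∀ m, K.map shift^[m] = K := by
    intro m
    induction m with
    | zero => simp
    | succ m ih => rw [Function.iterate_succ', ← Multiset.map_map, ih, hshift]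
  -- Every necklace has length at most `n`, so `n!` is a common period.
  have hper : ∀ v ∈ K, shift^[n.factorial] v = v := by
    intro v hv
    obtain ⟨c, hc, hv⟩ := Multiset.mem_bind.1 hv
    obtain ⟨l, hl, rfl⟩ := Multiset.mem_map.1 hv
    rw [Cycle.mem_lists_iff_coe_eq] at hl
    subst hl
    have hlen : l.length ≤ n := by
      rw [← hn, ← Cycle.length_coe, ← Cycle.card_toMultiset]
      exact Multiset.card_le_card (Multiset.le_bind M hc)
    exact (isPeriodicPt_periodicWord l).trans_dvd
      (Nat.dvd_factorial (List.length_pos_iff.2 (hM _ hc l rfl).1) hlen)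
  obtain ⟨V, hV, hVK⟩ := exists_monotone_map_eq (n := n) (K.map toLex) (by simpa using hcard)
  obtain ⟨v, rfl⟩ : ∃ v : Fin n → ℕ → α, V = fun x => toLex (v x) := ⟨fun x => ofLex (V x), rfl⟩
  have hvK : univ.val.map v = K := by
    refine Multiset.map_injective toLex.injective ?_
    rw [← hVK, Multiset.map_map]
    rfl
  -- On the readings `S` inverts `shift`: it prepends the cyclically preceding letter.
  set S : (ℕ → α) → ℕ → α := shift^[n.factorial - 1] with hS
  have hSv : ∀ x, shift (S (v x)) = v x := by
    intro x
    rw [hS, ← Function.iterate_succ_apply' shift, Nat.succ_eq_add_one,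
      Nat.sub_add_cancel n.factorial_pos]
    exact hper _ (hvK ▸ Multiset.mem_map_of_mem v (mem_univ x))
  set w : Fin n → α := fun x => S (v x) 0 with hw
  -- Along `(st w)⁻¹` the words `S (v x)` are ordered by first letter `w x`, and for equal first
  -- letters by position, that is, by their tails `v x`.
  have hmono : Monotone fun x => toLex (S (v ((st w)⁻¹ x))) := by
    intro x y hxy
    rcases hxy.eq_or_lt with rfl | hlt
    · exact le_rfl
    rcases before_inv_st w hlt with h | h
    · exact (toLex_lt_of_head_lt h).le
    · refine toLex_le_of_head_eq h.1 ?_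
      rw [hSv, hSv]
      exact hV h.2.le
  -- Both sides are monotone enumerations of `K`, which `S` permutes. Iterating the identity shows
  -- that `v` is `backward w`.
  have hrec : ∀ x, v x = S (v ((st w)⁻¹ x)) := by
    have h1 := eq_of_monotone_of_map_eq hV hmono (by
      rw [map_univ_perm (st w)⁻¹ fun x => toLex (S (v x)), hVK]
      rw [← hiter (n.factorial - 1), ← hvK]
      simp only [Multiset.map_map]
      rfl)
    exact fun x => toLex.injective (congrFun h1 x)
  have hback : ∀ k x, v x k = backward w x k := by
    intro k
    induction k with
    | zero =>
      intro x
      rw [hrec]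
      simp [backward, hw]
    | succ k ih =>
      intro x
      rw [hrec]
      change shift (S (v ((st w)⁻¹ x))) k = _
      rw [hSv, ih, backward, backward, pow_succ _ (k + 1), Equiv.Perm.mul_apply]
  refine ⟨w, eq_of_bind_readings_eq (fun c => isPrimitive_of_mem_U_neg_one w) hM ?_⟩
  rw [bind_readings_U_neg_one, ← hK, ← hvK]
  exact Multiset.map_congr rfl fun x _ => funext fun k => (hback k x).symm

end Reconstruction

/-! ### The bijections -/

theorem mem_necklacesOfContent_iff {a : ℕ} {r : Fin a → ℕ} {M : Multiset (Cycle (Fin a))} :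
    M ∈ necklacesOfContent r ↔
      (∀ c ∈ M, IsPrimitive c) ∧ ∀ i, (M.bind Cycle.toMultiset).count i = r i := by
  simp only [necklacesOfContent, Set.mem_ofPred_eq, Multiset.count_bind]

theorem bijOn_U_neg_one {n a : ℕ} {r : Fin a → ℕ} (hr : ∑ i, r i = n) :
    Set.BijOn (U (-1)) (wordsOfContent n r) (necklacesOfContent r) := by
  have hmem : ∀ w : Fin n → Fin a,
      U (-1) w ∈ necklacesOfContent r ↔ w ∈ wordsOfContent n r := by
    intro w
    rw [mem_necklacesOfContent_iff, mem_wordsOfContent_iff, bind_toMultiset_U_neg_one]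
    exact and_iff_right fun c => isPrimitive_of_mem_U_neg_one w
  refine ⟨fun w hw => (hmem w).2 hw, ?_, fun M hM => ?_⟩
  · intro w _ w' _ h
    funext x
    have : Inhabited (Fin a) := ⟨w x⟩
    exact congrFun (U_neg_one_injective h) x
  · have hM' := mem_necklacesOfContent_iff.1 hM
    have hcard : Multiset.card (M.bind Cycle.toMultiset) = n := by
      rw [← hr, ← Multiset.sum_count_eq_card (s := univ) fun x _ => mem_univ x]
      exact sum_congr rfl fun i _ => hM'.2 i
    suffices ∃ w : Fin n → Fin a, U (-1) w = M by
      obtain ⟨w, rfl⟩ := this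
      exact ⟨w, (hmem w).1 hM, rfl⟩
    -- The empty alphabet has no default letter for `periodicWord`; there both sides are empty.
    cases a with
    | succ a => exact exists_U_neg_one_eq hM'.1 hcard
    | zero =>
      obtain rfl : n = 0 := by simpa using hr.symm
      refine ⟨Fin.elim0, ?_⟩
      have hM0 : M = 0 := Multiset.eq_zero_of_forall_notMem fun c hc => by
        refine (hM'.1 c hc).ne_nil (Cycle.toMultiset_eq_nil.1 ?_)
        exact Multiset.eq_zero_of_forall_notMem fun i => i.elim0
      rw [hM0, U_neg_one]
      simp [cycles]

theorem isPrimitive_reverse {α : Type*} {c : Cycle α} (hc : IsPrimitive c) :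
    IsPrimitive c.reverse := by
  intro l hl
  have h := hc l.reverse (by rw [← Cycle.reverse_coe, hl, Cycle.reverse_reverse])
  refine ⟨by simpa using h.1, fun k hk hk' he => ?_⟩
  -- Rotating the reversed list by `l.length - k` is reversing the rotation by `k`.
  refine h.2 (l.length - k) (by omega) (by simp; omega) ?_
  rw [List.rotate_reverse]
  have : l.length - (l.length - k) % l.length = k := by
    rw [Nat.mod_eq_of_lt (by omega)]
    omega
  rw [this, he]

theorem bijOn_map_reverse {a : ℕ} (r : Fin a → ℕ) :
    Set.BijOn (Multiset.map Cycle.reverse) (necklacesOfContent r) (necklacesOfContent r) := by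
  have hinv : ∀ M : Multiset (Cycle (Fin a)), (M.map Cycle.reverse).map Cycle.reverse = M := by
    intro M
    simp [Multiset.map_map]
  have hmaps : Set.MapsTo (Multiset.map Cycle.reverse) (necklacesOfContent r)
      (necklacesOfContent r) := by
    rintro M ⟨h1, h2⟩
    refine ⟨fun c hc => ?_, fun i => ?_⟩
    · obtain ⟨d, hd, rfl⟩ := Multiset.mem_map.1 hc
      exact isPrimitive_reverse (h1 d hd)
    · rw [← h2 i, Multiset.map_map]
      congr 1
      refine Multiset.map_congr rfl fun c _ => ?_
      induction c using Quotient.inductionOn' with | h l => ?_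
      exact congrArg (Multiset.count i) (Multiset.coe_eq_coe.2 (List.reverse_perm l))
  exact Set.BijOn.mk hmaps ((Function.LeftInverse.injective hinv).injOn)
    fun M hM => ⟨_, hmaps hM, hinv M⟩

theorem bijOn_U {n a : ℕ} {r : Fin a → ℕ} (hr : ∑ i, r i = n) (ε : ℤˣ) :
    Set.BijOn (U ε) (wordsOfContent n r) (necklacesOfContent r) := by
  rcases Int.units_eq_one_or ε with rfl | rfl
  · exact ((bijOn_map_reverse r).comp (bijOn_U_neg_one hr)).congr fun w _ => (U_one w).symm
  · exact bijOn_U_neg_one hr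

theorem map_length_U {n : ℕ} {α : Type*} [LinearOrder α] (ε : ℤˣ) (w : Fin n → α) :
    (U ε w).map Cycle.length = cycleLengths (st w) := by
  have h : (U ε w).map Cycle.length = cycleLengths (st w ^ (ε : ℤ)) := by
    rw [U, Multiset.map_map, ← map_length_cycles]
    refine Multiset.map_congr rfl fun c _ => ?_
    induction c using Quotient.inductionOn' with | h l => ?_
    exact List.length_map w
  rw [h]
  rcases Int.units_eq_one_or ε with rfl | rfl
  · simp
  · simpa using cycleLengths_inv (st w)

end GesselReutenauer

open GesselReutenauer in
theorem theorem3 (n a : ℕ) (r : Fin a → ℕ) (hr : ∑ i, r i = n) (ε : ℤˣ) :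
    Set.BijOn (U ε) (wordsOfContent n r) (necklacesOfContent r) ∧
    Set.BijOn st (wordsOfContent n r)
      {π : Equiv.Perm (Fin n) | descentSet π⁻¹ ⊆ partialSums r} ∧
    ∃ Ubar : Equiv.Perm (Fin n) → Multiset (Cycle (Fin a)),
      (∀ w ∈ wordsOfContent n r, Ubar (st w) = U ε w) ∧
      (Set.BijOn Ubar {π | descentSet π⁻¹ ⊆ partialSums r} (necklacesOfContent r) ∧
        ∀ π, descentSet π⁻¹ ⊆ partialSums r →
          (Ubar π).map Cycle.length = cycleLengths π) ∧
      (Set.BijOn (fun π => Ubar π⁻¹) {π | descentSet π ⊆ partialSums r} (necklacesOfContent r) ∧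
        ∀ π, descentSet π ⊆ partialSums r →
          (Ubar π⁻¹).map Cycle.length = cycleLengths π) := by
  have hU := bijOn_U hr ε
  have hst := bijOn_st hr
  obtain ⟨u, -, -⟩ := exists_monotone_mem_wordsOfContent hr
  have : Nonempty (Fin n → Fin a) := ⟨u⟩
  -- `Ubar` is `U ε` after this inverse of `st`; its values at permutations violating the descent
  -- condition are irrelevant.
  set inv := Function.invFunOn (st : (Fin n → Fin a) → _) (wordsOfContent n r)
  have hinv : Set.InvOn inv st (wordsOfContent n r) {π | descentSet π⁻¹ ⊆ partialSums r} :=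
    hst.invOn_invFunOn
  have hbij : Set.BijOn (fun π => U ε (inv π)) {π | descentSet π⁻¹ ⊆ partialSums r}
      (necklacesOfContent r) := hU.comp (hst.symm hinv.symm)
  have hlen : ∀ π : Equiv.Perm (Fin n), descentSet π⁻¹ ⊆ partialSums r →
      (U ε (inv π)).map Cycle.length = cycleLengths π := by
    intro π hπ
    rw [map_length_U, hinv.2 hπ]
  refine ⟨hU, hst, fun π => U ε (inv π), fun w hw => by simp only [hinv.1 hw], ⟨hbij, hlen⟩,
    hbij.comp ?_, fun π hπ => ?_⟩
  · refine ⟨fun π hπ => ?_, inv_injective.injOn, fun π hπ => ⟨π⁻¹, hπ, inv_inv π⟩⟩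
    change descentSet π⁻¹⁻¹ ⊆ _
    rwa [inv_inv]
  · rw [hlen π⁻¹ (by rwa [inv_inv]), cycleLengths_inv]
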